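/- Let $\Gamma$ be a discrete group acting by homeomorphisms on a compact Hausdorff space $X$. Let $C_c(X\rtimes\Gamma)$ be the convolution $*$-algebra of finite formal sums $\sum f_s s$ with $s\in\Gamma$, $f_s\in C(X)$, where $(fs)(gt)=f\,(s.g)\,st$, $(fs)^*=(s^{-1}.\bar f)\,s^{-1}$ and $(s.g)(x)=g(s^{-1}.x)$. For an ideal $D\triangleleft\ell^\infty(\Gamma)$ (algebraic, not necessarily closed), a unitary representation $\pi$ of $\Gamma$ on a Hilbert space $\mathcal H$ is a $D$-representation if there is a dense linear subspace $\mathcal H_0\subset\mathcal H$ such that for all $\xi,\eta\in\mathcal H_0$ the function $s\mapsto\langle\pi_s\xi,\eta\rangle$ belongs to $D$. A (unital) $*$-representation of $C_c(X\rtimes\Gamma)$ on a Hilbert space is a $D$-representation if its restriction to $\Gamma$ is one. Let $C^*_D(X\rtimes\Gamma)$ be the Hausdorff completion of $C_c(X\rtimes\Gamma)$ with respect to the (semi)norm $\|a\|_D=\sup\{\|\pi(a)\| : \pi \text{ a } D\text{-representation}\}$, and let $C^*(X\rtimes\Gamma)$ be the full crossed product, the completion with respect to the supremum of $\|\pi(a)\|$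 over all $*$-representations $\pi$. Let $c_c(\Gamma)$ and $c_0(\Gamma)$ be the ideals of finitely supported functions and of functions vanishing at infinity. A function $h\colon X\times\Gamma\to\mathbb C$ is positive definite if for all $s_1,\dots,s_n\in\Gamma$ and $x\in X$ the matrix $[h(s_i.x,\,s_is_j^{-1})]_{i,j}$ is positive semidefinite. The action is amenable (respectively a-T-menable) if there is a sequence of positive definite functions $h_n$ in $C_c(X\times\Gamma)$ (respectively in $C_0(X\times\Gamma)$) with $h_n\to1$ uniformly on compact subsets of $X\times\Gamma$. Then: 1. If the action of $\Gamma$ on $X$ is amenable, then $C^*(X\rtimes\Gamma)=C^*_{c_c}(X\rtimes\Gamma)$. 2. If the action of $\Gamma$ on $X$ is a-T-menable, then $C^*(X\rtimes\Gamma)=C^*_{c_0}(X\rtimes\Gamma)$. Here equality means that the identity map of $C_c(X\rtimes\Gamma)$ induces a $*$-isomorphism between the two completions. -/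

import Mathlib

open Filter Topology
open scoped ENNReal ComplexOrder

universe u v

noncomputable section

namespace CrossedProduct

theorem norm_unitary_le_one {E : Type*} [NormedRing E] [StarRing E] [CStarRing E]
    (U : unitary E) : ‖(U : E)‖ ≤ 1 := by
  rcases subsingleton_or_nontrivial E with h | h
  · simp [Subsingleton.elim (U : E) 0]
  · exact (CStarRing.norm_coe_unitary U).le

/-! ### Ideals of bounded functions and `D`-representations of a group -/

section Group

variable {Γ : Type u}

/-- `ℓ^∞(Γ)`, with pointwise operations. -/
abbrev EllInfty (Γ : Type u) : Type u := lp (fun _ : Γ => ℂ) ∞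

/-- The ideal `c_c(Γ)` of finitely supported functions. -/
def ccIdeal (Γ : Type u) : Ideal (EllInfty Γ) where
  carrier := {f | {s | f s ≠ 0}.Finite}
  zero_mem' := by simp
  add_mem' := by
    intro f g hf hg
    refine (Set.Finite.union hf hg).subset ?_
    intro s hs
    by_contra h
    simp only [Set.mem_union, Set.mem_ofPred_eq, not_or, not_not] at h
    exact hs (by simp [h.1, h.2])
  smul_mem' := by
    intro c f hf
    refine Set.Finite.subset hf ?_
    intro s hs h
    exact hs (by simp [h])

/-- The ideal `c_0(Γ)` of functions vanishing at infinity. -/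
def c0Ideal (Γ : Type u) : Ideal (EllInfty Γ) where
  carrier := {f | Tendsto (fun s => f s) cofinite (𝓝 0)}
  zero_mem' := by simpa using tendsto_const_nhds
  add_mem' := by
    intro f g hf hg
    simpa using Tendsto.add hf hg
  smul_mem' := by
    intro c f hf
    have hb : ∀ s, ‖c s‖ ≤ ‖c‖ := fun s => lp.norm_apply_le_norm (by simp) c s
    refine squeeze_zero_norm (a := fun s => ‖c‖ * ‖f s‖) (fun s => ?_) ?_
    · simp only [smul_eq_mul, lp.infty_coeFn_mul, Pi.mul_apply, norm_mul]
      exact mul_le_mul_of_nonneg_right (hb s) (norm_nonneg _)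
    · simpa using (tendsto_norm_zero.comp hf).const_mul ‖c‖

variable [Group Γ] {H : Type*} [NormedAddCommGroup H] [InnerProductSpace ℂ H] [CompleteSpace H]

/-- The matrix coefficient `s ↦ ⟨U_s ξ, η⟩` of a unitary representation, as an element of
`ℓ^∞(Γ)`. Mathlib's inner product is conjugate-linear in its first argument. -/
def matrixCoeff (U : Γ →* unitary (H →L[ℂ] H)) (ξ η : H) : EllInfty Γ :=
  ⟨fun s => inner ℂ η ((U s : H →L[ℂ] H) ξ), by
    refine memℓp_infty ⟨‖η‖ * ‖ξ‖, ?_⟩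
    rintro _ ⟨s, rfl⟩
    refine (norm_inner_le_norm _ _).trans ?_
    refine mul_le_mul_of_nonneg_left ?_ (norm_nonneg _)
    refine ((U s : H →L[ℂ] H).le_opNorm ξ).trans ?_
    have h1 : ‖(U s : H →L[ℂ] H)‖ ≤ 1 := norm_unitary_le_one (U s)
    simpa using mul_le_mul_of_nonneg_right h1 (norm_nonneg ξ)⟩

/-- A unitary representation is a `D`-representation if the matrix coefficients of the vectors
from some dense linear subspace belong to `D`. -/
def IsDRep (D : Ideal (EllInfty Γ)) (U : Γ →* unitary (H →L[ℂ] H)) : Prop :=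
  ∃ H₀ : Submodule ℂ H, Dense (H₀ : Set H) ∧ ∀ ξ ∈ H₀, ∀ η ∈ H₀, matrixCoeff U ξ η ∈ D

end Group

/-! ### The convolution algebra `C_c(X ⋊ Γ)` -/

section Convolution

/-- The C⋆-algebra `C(X)` of continuous complex functions on a compact space, with Mathlib's
operations and supremum norm. -/
def CFun (X : Type v) [TopologicalSpace X] : Type v := C(X, ℂ)

instance (X : Type v) [TopologicalSpace X] : FunLike (CFun X) X ℂ :=
  inferInstanceAs (FunLike C(X, ℂ) X ℂ)

instance (X : Type v) [TopologicalSpace X] [CompactSpace X] : CommCStarAlgebra (CFun X) :=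
  inferInstanceAs (CommCStarAlgebra C(X, ℂ))

variable {Γ : Type u} {X : Type v} [Group Γ] [TopologicalSpace X] [CompactSpace X] [MulAction Γ X]
  [ContinuousConstSMul Γ X]

/-- The action of `Γ` on `C(X)` by `(s • f)(x) = f(s⁻¹ • x)`. -/
instance actionOnFunctions : MulSemiringAction Γ (CFun X) where
  smul s f := ContinuousMap.comp f ⟨fun x => s⁻¹ • x, continuous_const_smul _⟩
  one_smul f := DFunLike.ext _ _ fun x => congrArg f (by simp)
  mul_smul s t f := DFunLike.ext _ _ fun x => congrArg f (by simp [mul_smul])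
  smul_zero s := rfl
  smul_add s f g := rfl
  smul_one s := rfl
  smul_mul s f g := rfl

theorem action_apply (s : Γ) (f : CFun X) (x : X) : (s • f) x = f (s⁻¹ • x) := rfl

instance : SMulCommClass Γ ℂ (CFun X) where
  smul_comm _ _ _ := rfl

theorem action_star (s : Γ) (f : CFun X) : star (s • f) = s • star f := rfl

variable (Γ X) in
/-- The convolution algebra `C_c(X ⋊ Γ)`: finite formal sums `∑ f_s s` with `f_s ∈ C(X)`,
multiplied by `(f s) (g t) = f (s • g) (s t)`; the term `f s` is `SkewMonoidAlgebra.single s f`. -/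
abbrev ConvAlg : Type (max u v) := SkewMonoidAlgebra (CFun X) Γ

open SkewMonoidAlgebra in
/-- The involution `(f s)^* = (s⁻¹ • conj f) s⁻¹`, extended additively. -/
instance : Star (ConvAlg Γ X) where
  star a := a.sum fun s f => single s⁻¹ (s⁻¹ • star f)

open SkewMonoidAlgebra in
theorem star_single (s : Γ) (f : CFun X) :
    star (single s f : ConvAlg Γ X) = single s⁻¹ (s⁻¹ • star f) :=
  sum_single_index (by simp)

open SkewMonoidAlgebra in
theorem star_add' (a b : ConvAlg Γ X) : star (a + b) = star a + star b :=
  sum_add_index' (by simp) (by intro s f g; simp [single_add])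

open SkewMonoidAlgebra in
instance : StarRing (ConvAlg Γ X) where
  star_involutive a := by
    induction a using SkewMonoidAlgebra.induction_on with
    | zero => rfl
    | single s f => simp [star_single, action_star]
    | add a b ha hb => rw [star_add', star_add', ha, hb]
  star_add := star_add'
  star_mul a b := by
    have h0 : star (0 : ConvAlg Γ X) = 0 := rfl
    induction a using SkewMonoidAlgebra.induction_on with
    | zero => simp [h0]
    | add a a' ha ha' => rw [add_mul, star_add', ha, ha', star_add', mul_add]
    | single s f =>
      induction b using SkewMonoidAlgebra.induction_on with
      | zero => simp [h0]
      | add b b' hb hb' => rw [mul_add, star_add', hb, hb', star_add', add_mul]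
      | single t g =>
        simp only [single_mul_single, star_single, star_mul', smul_mul', mul_inv_rev, action_star,
          smul_smul, inv_mul_cancel_right]
        rw [mul_comm]

open SkewMonoidAlgebra in
instance : StarModule ℂ (ConvAlg Γ X) where
  star_smul c a := by
    have h0 : star (0 : ConvAlg Γ X) = 0 := rfl
    induction a using SkewMonoidAlgebra.induction_on with
    | zero => simp [h0]
    | add a b ha hb => rw [smul_add, star_add', ha, hb, star_add', smul_add]
    | single s f => simp [star_single, smul_single, smul_comm]

open SkewMonoidAlgebra in
/-- The inclusion of `Γ` into the unitary group of the convolution algebra, `s ↦ 1 s`. -/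
def groupInclusion : Γ →* unitary (ConvAlg Γ X) where
  toFun s := ⟨single s 1, by
    rw [Unitary.mem_iff]
    simp [star_single, single_mul_single]⟩
  map_one' := rfl
  map_mul' s t := by
    ext1
    simp [single_mul_single]

end Convolution

/-! ### Representations and the associated norms -/

section Completion

variable (Γ : Type u) (X : Type v) [Group Γ] [TopologicalSpace X] [CompactSpace X] [MulAction Γ X]
  [ContinuousConstSMul Γ X]

/-- A (unital) `*`-representation of the convolution algebra on a complex Hilbert space.
The universe is large enough to contain all cyclic representations. -/
structure Rep where
  H : Type (max u v)
  [normed : NormedAddCommGroup H]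
  [inner : InnerProductSpace ℂ H]
  [complete : CompleteSpace H]
  π : ConvAlg Γ X →⋆ₐ[ℂ] (H →L[ℂ] H)

attribute [instance] Rep.normed Rep.inner Rep.complete

variable {Γ X}

/-- The restriction `π|_Γ`, a unitary representation of `Γ`. -/
def Rep.restrict (ρ : Rep Γ X) : Γ →* unitary (ρ.H →L[ℂ] ρ.H) where
  toFun s := ⟨ρ.π (groupInclusion s : unitary (ConvAlg Γ X)),
    Unitary.map_mem ρ.π (groupInclusion s).2⟩
  map_one' := by ext1; simp
  map_mul' s t := by ext1; simp

/-- A `*`-representation of the convolution algebra is a `D`-representation if its restriction to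
`Γ` is one. -/
def Rep.IsDRep (D : Ideal (EllInfty Γ)) (ρ : Rep Γ X) : Prop :=
  CrossedProduct.IsDRep D ρ.restrict

/-- The supremum of `‖π(a)‖` over the `*`-representations `π` in the class `P`. -/
def repNorm (P : Rep Γ X → Prop) (a : ConvAlg Γ X) : ℝ :=
  ⨆ ρ : {ρ : Rep Γ X // P ρ}, ‖ρ.1.π a‖

variable (P : Rep Γ X → Prop)

theorem norm_rep_single_le (ρ : Rep Γ X) (s : Γ) (f : CFun X) :
    ‖ρ.π (SkewMonoidAlgebra.single s f)‖ ≤ ‖f‖ := by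
  let j : CFun X →⋆ₐ[ℂ] ConvAlg Γ X :=
    { SkewMonoidAlgebra.singleOneRingHom with
      commutes' := fun c => rfl
      map_star' := fun f => by
        change SkewMonoidAlgebra.single 1 (star f) = star (SkewMonoidAlgebra.single 1 f)
        simp [star_single] }
  have h1 : ‖ρ.π (j f)‖ ≤ ‖f‖ := NonUnitalStarAlgHom.norm_apply_le (ρ.π.comp j) f
  have h2 : (SkewMonoidAlgebra.single s f : ConvAlg Γ X)
      = j f * (groupInclusion s : unitary (ConvAlg Γ X)) := by
    change _ = SkewMonoidAlgebra.single 1 f * SkewMonoidAlgebra.single s 1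
    simp [SkewMonoidAlgebra.single_mul_single]
  rw [h2, map_mul]
  have h3 : ‖ρ.π (groupInclusion s : unitary (ConvAlg Γ X))‖ ≤ 1 :=
    norm_unitary_le_one (ρ.restrict s)
  calc _ ≤ ‖ρ.π (j f)‖ * ‖ρ.π (groupInclusion s : unitary (ConvAlg Γ X))‖ := norm_mul_le _ _
    _ ≤ ‖f‖ * 1 := mul_le_mul h1 h3 (norm_nonneg _) (norm_nonneg _)
    _ = ‖f‖ := mul_one _

theorem repNorm_bddAbove (a : ConvAlg Γ X) :
    BddAbove (Set.range fun ρ : {ρ : Rep Γ X // P ρ} => ‖ρ.1.π a‖) := by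
  suffices h : ∃ C : ℝ, ∀ ρ : Rep Γ X, ‖ρ.π a‖ ≤ C by
    obtain ⟨C, hC⟩ := h
    exact ⟨C, by rintro _ ⟨ρ, rfl⟩; exact hC ρ.1⟩
  induction a using SkewMonoidAlgebra.induction_on with
  | zero => exact ⟨0, fun ρ => by simp⟩
  | single s f => exact ⟨‖f‖, fun ρ => norm_rep_single_le ρ s f⟩
  | add a b ha hb =>
    obtain ⟨C, hC⟩ := ha
    obtain ⟨C', hC'⟩ := hb
    exact ⟨C + C', fun ρ => by
      rw [map_add]; exact (norm_add_le _ _).trans (add_le_add (hC ρ) (hC' ρ))⟩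

theorem le_repNorm (a : ConvAlg Γ X) (ρ : Rep Γ X) (hρ : P ρ) : ‖ρ.π a‖ ≤ repNorm P a :=
  le_ciSup (repNorm_bddAbove P a) (⟨ρ, hρ⟩ : {ρ : Rep Γ X // P ρ})

theorem repNorm_nonneg (a : ConvAlg Γ X) : 0 ≤ repNorm P a :=
  Real.iSup_nonneg fun _ => norm_nonneg _

theorem repNorm_le {a : ConvAlg Γ X} {C : ℝ} (hC : 0 ≤ C) (h : ∀ ρ : Rep Γ X, P ρ → ‖ρ.π a‖ ≤ C) :
    repNorm P a ≤ C :=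
  Real.iSup_le (fun ρ => h ρ.1 ρ.2) hC

theorem repNorm_star (a : ConvAlg Γ X) : repNorm P (star a) = repNorm P a := by
  simp only [repNorm, map_star, norm_star]

theorem repNorm_mul_self_le (a : ConvAlg Γ X) :
    repNorm P a * repNorm P a ≤ repNorm P (star a * a) := by
  have h : repNorm P a ≤ √(repNorm P (star a * a)) := by
    refine repNorm_le P (Real.sqrt_nonneg _) fun ρ hρ => Real.le_sqrt_of_sq_le ?_
    have := le_repNorm P (star a * a) ρ hρ
    rwa [map_mul, map_star, CStarRing.norm_star_mul_self, ← sq] at this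
  calc _ ≤ √(repNorm P (star a * a)) * √(repNorm P (star a * a)) :=
        mul_le_mul h h (repNorm_nonneg P a) (Real.sqrt_nonneg _)
    _ = _ := Real.mul_self_sqrt (repNorm_nonneg P _)

/-- The convolution algebra, endowed with the (semi)norm given by the class `P` of
representations. -/
def Pre (_ : Rep Γ X → Prop) : Type (max u v) := ConvAlg Γ X

instance : Ring (Pre P) := inferInstanceAs (Ring (ConvAlg Γ X))
instance : Algebra ℂ (Pre P) := inferInstanceAs (Algebra ℂ (ConvAlg Γ X))
instance : StarRing (Pre P) := inferInstanceAs (StarRing (ConvAlg Γ X))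
instance : StarModule ℂ (Pre P) := inferInstanceAs (StarModule ℂ (ConvAlg Γ X))

/-- The norm on `Pre P`: the supremum of `‖π(a)‖` over the representations `π` in `P`. -/
def Pre.groupSeminorm : AddGroupSeminorm (Pre P) where
  toFun := repNorm P
  map_zero' := by
    refine le_antisymm (repNorm_le P le_rfl fun ρ _ => ?_) (repNorm_nonneg P _)
    exact (norm_eq_zero.2 (map_zero ρ.π)).le
  add_le' a b := by
    refine repNorm_le P (add_nonneg (repNorm_nonneg P _) (repNorm_nonneg P _)) fun ρ hρ => ?_
    refine (congrArg norm (map_add ρ.π a b)).le.trans ((norm_add_le _ _).trans ?_)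
    exact add_le_add (le_repNorm P a ρ hρ) (le_repNorm P b ρ hρ)
  neg' a := by
    refine congrArg iSup (funext fun ρ => ?_)
    exact (congrArg norm (map_neg ρ.1.π a)).trans (norm_neg _)

instance : SeminormedRing (Pre P) where
  __ := (Pre.groupSeminorm P).toSeminormedAddCommGroup
  __ := (inferInstance : Ring (Pre P))
  norm_mul_le a b := by
    refine repNorm_le P (mul_nonneg (repNorm_nonneg P _) (repNorm_nonneg P _)) fun ρ hρ => ?_
    refine (congrArg norm (map_mul ρ.π a b)).le.trans ((norm_mul_le _ _).trans ?_)
    exact mul_le_mul (le_repNorm P a ρ hρ) (le_repNorm P b ρ hρ) (norm_nonneg _)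
      (repNorm_nonneg P _)

theorem Pre.norm_def (a : Pre P) : ‖a‖ = repNorm P a := rfl

instance : NormedAlgebra ℂ (Pre P) where
  norm_smul_le c a := by
    refine repNorm_le P (mul_nonneg (norm_nonneg _) (repNorm_nonneg P _)) fun ρ hρ => ?_
    refine (congrArg norm (map_smul ρ.π c a)).le.trans ((norm_smul_le _ _).trans ?_)
    exact mul_le_mul_of_nonneg_left (le_repNorm P a ρ hρ) (norm_nonneg _)

instance : NormedStarGroup (Pre P) where
  norm_star_le a := (repNorm_star P a).le

theorem Pre.norm_mul_self_le (a : Pre P) : ‖a‖ * ‖a‖ ≤ ‖star a * a‖ := repNorm_mul_self_le P a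

/-- The Hausdorff completion of the convolution algebra with respect to the norm given by the
class `P` of representations. -/
def CStarCompletion : Type (max u v) := UniformSpace.Completion (Pre P)

namespace CStarCompletion

open UniformSpace.Completion

instance : NormedRing (CStarCompletion P) :=
  inferInstanceAs (NormedRing (UniformSpace.Completion (Pre P)))
instance : CompleteSpace (CStarCompletion P) :=
  inferInstanceAs (CompleteSpace (UniformSpace.Completion (Pre P)))
instance : NormedSpace ℂ (CStarCompletion P) :=
  inferInstanceAs (NormedSpace ℂ (UniformSpace.Completion (Pre P)))
instance : Algebra ℂ (CStarCompletion P) :=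
  inferInstanceAs (Algebra ℂ (UniformSpace.Completion (Pre P)))

instance : NormedAlgebra ℂ (CStarCompletion P) where
  norm_smul_le c a := norm_smul_le (α := ℂ) (β := UniformSpace.Completion (Pre P)) c a

/-- The canonical map into the completion. -/
def coe (a : Pre P) : CStarCompletion P := (a : UniformSpace.Completion (Pre P))

variable {P} in
theorem ind {p : CStarCompletion P → Prop} (a : CStarCompletion P) (hp : IsClosed {a | p a})
    (h : ∀ a : Pre P, p (coe P a)) : p a :=
  UniformSpace.Completion.induction_on a hp h

theorem continuous_coe : Continuous (coe P) := UniformSpace.Completion.continuous_coe _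
theorem norm_coe (a : Pre P) : ‖coe P a‖ = ‖a‖ := UniformSpace.Completion.norm_coe a
theorem coe_add (a b : Pre P) : coe P (a + b) = coe P a + coe P b :=
  UniformSpace.Completion.coe_add a b
theorem coe_mul (a b : Pre P) : coe P (a * b) = coe P a * coe P b :=
  UniformSpace.Completion.coe_mul a b
theorem coe_smul (c : ℂ) (a : Pre P) : coe P (c • a) = c • coe P a :=
  UniformSpace.Completion.coe_smul c a

/-- The involution, extended by continuity. -/
instance : Star (CStarCompletion P) where
  star := UniformSpace.Completion.map (star : Pre P → Pre P)

theorem uniformContinuous_star_pre : UniformContinuous (star : Pre P → Pre P) :=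
  (starNormedAddGroupHom (E := Pre P)).uniformContinuous

theorem continuous_star' : Continuous (star : CStarCompletion P → CStarCompletion P) :=
  UniformSpace.Completion.continuous_map

theorem coe_star (a : Pre P) : coe P (star a) = star (coe P a) :=
  (UniformSpace.Completion.map_coe (uniformContinuous_star_pre P) a).symm

instance : StarRing (CStarCompletion P) where
  star_involutive a := by
    refine ind (p := fun a => star (star a) = a) a ?_ fun a => ?_
    · exact isClosed_eq ((continuous_star' P).comp (continuous_star' P)) continuous_id
    · rw [← coe_star, ← coe_star, star_star]
  star_add a b := by
    refine ind (p := fun a => star (a + b) = star a + star b) a ?_ fun a => ?_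
    · exact isClosed_eq ((continuous_star' P).comp (continuous_add_const b))
        ((continuous_star' P).add continuous_const)
    refine ind (p := fun b => star (coe P a + b) = star (coe P a) + star b) b ?_ fun b => ?_
    · exact isClosed_eq ((continuous_star' P).comp (continuous_const_add _))
        (continuous_const.add (continuous_star' P))
    · rw [← coe_add, ← coe_star, star_add, coe_add, coe_star, coe_star]
  star_mul a b := by
    refine ind (p := fun a => star (a * b) = star b * star a) a ?_ fun a => ?_
    · exact isClosed_eq ((continuous_star' P).comp (continuous_mul_const b))
        (continuous_const.mul (continuous_star' P))
    refine ind (p := fun b => star (coe P a * b) = star b * star (coe P a)) b ?_ fun b => ?_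
    · exact isClosed_eq ((continuous_star' P).comp (continuous_const_mul _))
        ((continuous_star' P).mul continuous_const)
    · rw [← coe_mul, ← coe_star, star_mul, coe_mul, coe_star, coe_star]

instance : StarModule ℂ (CStarCompletion P) where
  star_smul c a := by
    refine ind (p := fun a => star (c • a) = star c • star a) a ?_ fun a => ?_
    · exact isClosed_eq ((continuous_star' P).comp (continuous_const_smul c))
        ((continuous_star' P).const_smul (star c))
    · rw [← coe_smul, ← coe_star, star_smul, coe_smul, coe_star]

instance : CStarRing (CStarCompletion P) where
  norm_mul_self_le a := by
    refine ind (p := fun a => ‖a‖ * ‖a‖ ≤ ‖star a * a‖) a ?_ fun a => ?_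
    · exact isClosed_le (continuous_norm.mul continuous_norm)
        (((continuous_star' P).mul continuous_id).norm)
    · rw [← coe_star, ← coe_mul, norm_coe, norm_coe]
      exact Pre.norm_mul_self_le P a

instance : CStarAlgebra (CStarCompletion P) where

/-- The canonical `*`-homomorphism from the convolution algebra to the completion. -/
def of : ConvAlg Γ X →⋆ₐ[ℂ] CStarCompletion P where
  toFun := coe P
  map_one' := rfl
  map_mul' := coe_mul P
  map_zero' := rfl
  map_add' := coe_add P
  commutes' _ := rfl
  map_star' := coe_star P

theorem norm_of (a : ConvAlg Γ X) : ‖of P a‖ = repNorm P a := norm_coe P a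

end CStarCompletion

variable (Γ X) in
/-- The full crossed product `C^*(X ⋊ Γ)`: the completion with respect to the supremum over all
`*`-representations. -/
abbrev FullCrossedProduct : Type (max u v) := CStarCompletion (fun _ : Rep Γ X => True)

variable (X) in
/-- The ideal completion `C^*_D(X ⋊ Γ)`: the completion with respect to the supremum over all
`D`-representations. -/
abbrev IdealCompletion (D : Ideal (EllInfty Γ)) : Type (max u v) :=
  CStarCompletion (fun ρ : Rep Γ X => ρ.IsDRep D)

variable (X) in
/-- `C^*(X ⋊ Γ) = C^*_D(X ⋊ Γ)`: there is a `*`-isomorphism which is the identity on the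
convolution algebra. -/
def FullEqIdealCompletion (D : Ideal (EllInfty Γ)) : Prop :=
  ∃ Φ : FullCrossedProduct Γ X ≃⋆ₐ[ℂ] IdealCompletion X D,
    ∀ a : ConvAlg Γ X, Φ (CStarCompletion.of _ a) = CStarCompletion.of _ a

end Completion

/-! ### Amenable and a-T-menable actions -/

section Actions

variable (Γ : Type u) (X : Type v) [Group Γ] [TopologicalSpace X] [MulAction Γ X]
  [TopologicalSpace Γ]

variable {Γ X} in
/-- Positive definiteness of a function on `X × Γ`. -/
def PositiveDefinite (h : X × Γ → ℂ) : Prop :=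
  ∀ (n : ℕ) (s : Fin n → Γ) (x : X),
    (Matrix.of fun i j => h (s i • x, s i * (s j)⁻¹)).PosSemidef

/-- The action is amenable: there are positive definite functions in `C_c(X × Γ)` converging to
`1` uniformly on compact sets. -/
def IsAmenableAction : Prop :=
  ∃ h : ℕ → CompactlySupportedContinuousMap (X × Γ) ℂ, (∀ n, PositiveDefinite (h n)) ∧
    ∀ K : Set (X × Γ), IsCompact K →
      TendstoUniformlyOn (fun n p => h n p) (fun _ => (1 : ℂ)) atTop K

/-- The action is a-T-menable: there are positive definite functions in `C_0(X × Γ)` converging to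
`1` uniformly on compact sets. -/
def IsATMenableAction : Prop :=
  ∃ h : ℕ → ZeroAtInftyContinuousMap (X × Γ) ℂ, (∀ n, PositiveDefinite (h n)) ∧
    ∀ K : Set (X × Γ), IsCompact K →
      TendstoUniformlyOn (fun n p => h n p) (fun _ => (1 : ℂ)) atTop K

end Actions

end CrossedProduct

end

noncomputable section

namespace CrossedProduct

/-! ### Continuous factorization of positive semidefinite matrices -/

section Factorization

open scoped Matrix.Norms.L2Operator MatrixOrder Matrix

/-! A positive definite `h` gives Fourier-type multipliers `∑ f_s s ↦ ∑ f_s k_s s` with `k_s = h(·,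
s)`. Positive definiteness makes such a multiplier send `a^* a` to a finite sum of squares `c^* c`
inside the convolution algebra (`exists_multiplier_star_mul_self`). Hence, for any representation
`π` and vector `ξ`, the functional `φ(a) = ⟨π(m_k a) ξ, ξ⟩` is positive, and it has a GNS
representation.

In that representation the image of the algebra is dense, and the matrix coefficients of its vectors
are sums of functions dominated by multiples of two-sided translates of `s ↦ ‖k_s‖`. So decay of `h`
in the group variable turns the GNS representation into a `D`-representation (`isDRep_gns`), and
`|φ(a^* a)| ≤ ‖a^* a‖_D φ(1)`.

As `h_n → 1` uniformly on each compact slice `X × {s}`, the functionals `φ_n` converge pointwise to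
the vector functional of `ξ`. The limit of the inequality is `‖π(a) ξ‖² ≤ ‖a‖_D² ‖ξ‖²`, so the full
norm is at most the `D`-norm (`repNorm_eq_of_multipliers`). The reverse inequality is trivial, and
equal seminorms give isomorphic completions. -/

/-- The factor is the positive square root, which depends continuously on the matrix by continuity
of the functional calculus. Continuity in `x` is what lets the entries of the factor serve as
coefficients in `C(X)`. -/
theorem exists_continuous_conjTranspose_mul_self {X n : Type*} [TopologicalSpace X] [Fintype n]
    [DecidableEq n] (F : X → Matrix n n ℂ) (hF : Continuous F) (hp : ∀ x, (F x).PosSemidef) :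
    ∃ G : X → Matrix n n ℂ, Continuous G ∧ ∀ x, F x = (G x)ᴴ * G x := by
  have hp' : ∀ x, 0 ≤ F x := fun x => (hp x).nonneg
  refine ⟨fun x => cfc NNReal.sqrt (F x), ?_, fun x => ?_⟩
  -- The square root is continuous on all of `ℝ≥0`, so the whole half-line serves as a common
  -- neighbourhood of the spectra.
  · exact Continuous.cfc_nnreal_of_mem_nhdsSet (s := Set.univ) NNReal.sqrt Filter.univ_mem hF hp'
  · have h : IsSelfAdjoint (cfc NNReal.sqrt (F x)) :=
      IsSelfAdjoint.of_nonneg (cfc_predicate NNReal.sqrt (F x))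
    have h2 : (cfc NNReal.sqrt (F x))ᴴ = cfc NNReal.sqrt (F x) := h
    rw [h2, ← cfc_mul NNReal.sqrt NNReal.sqrt (F x)]
    simp only [NNReal.mul_self_sqrt]
    exact (cfc_id' _ _ (hp' x)).symm

end Factorization

/-! ### The GNS construction for positive functionals on a `*`-algebra -/

/-- A positive linear functional on a `*`-algebra. -/
structure PositiveFunctional (A : Type*) [Ring A] [StarRing A] [Algebra ℂ A] where
  toLinearMap : A →ₗ[ℂ] ℂ
  nonneg : ∀ a, 0 ≤ toLinearMap (star a * a)

namespace PositiveFunctional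

variable {A : Type*} [Ring A] [StarRing A] [Algebra ℂ A] [StarModule ℂ A]

/-- Polarization: `φ` is real on the squares of `1`, `a`, `1 + a` and `1 + i a`. The third gives
opposite imaginary parts of `φ(a)` and `φ(a^*)`, the fourth equal real parts. -/
theorem map_star (φ : PositiveFunctional A) (a : A) :
    φ.toLinearMap (star a) = star (φ.toLinearMap a) := by
  have h0 := (Complex.nonneg_iff.1 (φ.nonneg 1)).2
  have ha := (Complex.nonneg_iff.1 (φ.nonneg a)).2
  have h1 := (Complex.nonneg_iff.1 (φ.nonneg (1 + a))).2
  have h2 := (Complex.nonneg_iff.1 (φ.nonneg (1 + Complex.I • a))).2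
  simp only [star_add, star_one, star_smul, add_mul, mul_add, one_mul, mul_one, map_add,
    smul_mul_assoc, mul_smul_comm, map_smul, smul_eq_mul, Complex.add_im, Complex.mul_im,
    Complex.I_re, Complex.I_im, Complex.star_def, Complex.conj_re, Complex.conj_im,
    Complex.mul_re] at h0 ha h1 h2
  apply Complex.ext
  · simp only [Complex.star_def, Complex.conj_re]
    linarith
  · simp only [Complex.star_def, Complex.conj_im]
    linarith

/-- The algebra, endowed with the semi-inner product `⟨a, b⟩ = φ(a^* b)`. -/
def PreGNS (_ : PositiveFunctional A) : Type _ := A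

variable (φ : PositiveFunctional A)

instance : AddCommGroup φ.PreGNS := inferInstanceAs (AddCommGroup A)
instance : Module ℂ φ.PreGNS := inferInstanceAs (Module ℂ A)

/-- The identity map of the algebra, with values in the semi-inner product space. -/
def toPreGNS : A ≃ₗ[ℂ] φ.PreGNS := LinearEquiv.refl ℂ A

/-- The semi-inner product `⟨a, b⟩ = φ(a^* b)`. -/
abbrev preInnerCore : PreInnerProductSpace.Core ℂ φ.PreGNS where
  inner a b := φ.toLinearMap (star (φ.toPreGNS.symm a) * φ.toPreGNS.symm b)
  conj_inner_symm a b := by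
    rw [starRingEnd_apply, ← φ.map_star, star_mul, star_star]
  re_inner_nonneg a := (Complex.nonneg_iff.1 (φ.nonneg _)).1
  add_left a b c := by rw [map_add, star_add, add_mul, map_add]
  smul_left a b c := by simp

instance : SeminormedAddCommGroup φ.PreGNS :=
  InnerProductSpace.Core.toSeminormedAddCommGroup (c := φ.preInnerCore)
instance : InnerProductSpace ℂ φ.PreGNS := InnerProductSpace.ofCore φ.preInnerCore

theorem inner_toPreGNS (a b : A) :
    inner ℂ (φ.toPreGNS a) (φ.toPreGNS b) = φ.toLinearMap (star a * b) := rfl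

theorem norm_toPreGNS_sq (a : A) : ‖φ.toPreGNS a‖ ^ 2 = (φ.toLinearMap (star a * a)).re := by
  rw [← φ.inner_toPreGNS, ← inner_self_eq_norm_sq (𝕜 := ℂ)]
  rfl

/-- Left multiplication by `a` is bounded for the semi-inner product. -/
def IsLeftBounded (a : A) : Prop :=
  ∃ C : ℝ, ∀ b : A, ‖φ.toPreGNS (a * b)‖ ≤ C * ‖φ.toPreGNS b‖

variable {φ} in
theorem IsLeftBounded.add {a b : A} (ha : φ.IsLeftBounded a) (hb : φ.IsLeftBounded b) :
    φ.IsLeftBounded (a + b) := by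
  obtain ⟨C, hC⟩ := ha
  obtain ⟨C', hC'⟩ := hb
  refine ⟨C + C', fun c => ?_⟩
  rw [add_mul, map_add, add_mul]
  exact (norm_add_le _ _).trans (add_le_add (hC c) (hC' c))

theorem isLeftBounded_zero : φ.IsLeftBounded 0 := ⟨0, fun b => by simp⟩

variable (hφ : ∀ a, φ.IsLeftBounded a)

/-- Left multiplication as a bounded operator. -/
def leftMul (a : A) : φ.PreGNS →L[ℂ] φ.PreGNS :=
  (φ.toPreGNS.toLinearMap ∘ₗ LinearMap.mulLeft ℂ a ∘ₗ φ.toPreGNS.symm.toLinearMap).mkContinuous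
    (hφ a).choose fun b => (hφ a).choose_spec (φ.toPreGNS.symm b)

theorem leftMul_apply (a b : A) : φ.leftMul hφ a (φ.toPreGNS b) = φ.toPreGNS (a * b) := rfl

/-- The GNS Hilbert space. -/
abbrev GNS := UniformSpace.Completion φ.PreGNS

/-- The canonical map into the GNS Hilbert space. -/
def toGNS : A →ₗ[ℂ] φ.GNS :=
  (UniformSpace.Completion.toComplₗᵢ (𝕜 := ℂ) (E := φ.PreGNS)).toLinearMap ∘ₗ
    φ.toPreGNS.toLinearMap

theorem toGNS_apply (a : A) : φ.toGNS a = (φ.toPreGNS a : φ.GNS) := rfl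

theorem inner_toGNS (a b : A) : inner ℂ (φ.toGNS a) (φ.toGNS b) = φ.toLinearMap (star a * b) := by
  rw [toGNS_apply, toGNS_apply, UniformSpace.Completion.inner_coe, inner_toPreGNS]

theorem denseRange_toGNS : DenseRange φ.toGNS :=
  UniformSpace.Completion.denseRange_coe.comp φ.toPreGNS.surjective.denseRange
    (UniformSpace.Completion.continuous_coe _)

variable {φ} in
theorem gns_ind {p : φ.GNS → Prop} (x : φ.GNS) (hp : IsClosed {x | p x})
    (h : ∀ a, p (φ.toGNS a)) : p x :=
  φ.denseRange_toGNS.induction_on x hp h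

/-- The operator of left multiplication on the GNS Hilbert space. -/
def gnsOperator (a : A) : φ.GNS →L[ℂ] φ.GNS := (φ.leftMul hφ a).completion

theorem gnsOperator_apply (a b : A) : φ.gnsOperator hφ a (φ.toGNS b) = φ.toGNS (a * b) := by
  rw [gnsOperator, toGNS_apply, ContinuousLinearMap.completion_apply_coe, leftMul_apply]
  rfl

variable {φ} in
theorem operator_ext {S T : φ.GNS →L[ℂ] φ.GNS} (h : ∀ a, S (φ.toGNS a) = T (φ.toGNS a)) : S = T := by
  ext x
  exact gns_ind x (isClosed_eq S.continuous T.continuous) h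

/-- The GNS representation. -/
def gnsRep : A →⋆ₐ[ℂ] (φ.GNS →L[ℂ] φ.GNS) where
  toFun := φ.gnsOperator hφ
  map_one' := operator_ext fun a => by simp [gnsOperator_apply]
  map_mul' a b := operator_ext fun c => by simp [gnsOperator_apply, mul_assoc]
  map_zero' := operator_ext fun c => by simp [gnsOperator_apply]
  map_add' a b := operator_ext fun c => by simp [gnsOperator_apply, add_mul]
  commutes' r := operator_ext fun c => by
    simp [gnsOperator_apply, Algebra.algebraMap_eq_smul_one]
  map_star' a := by
    refine (ContinuousLinearMap.eq_adjoint_iff _ _).2 fun x y => ?_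
    refine gns_ind (p := fun x => inner ℂ (φ.gnsOperator hφ (star a) x) y =
      inner ℂ x (φ.gnsOperator hφ a y)) x (isClosed_eq (by fun_prop) (by fun_prop)) fun b => ?_
    refine gns_ind (p := fun y => inner ℂ (φ.gnsOperator hφ (star a) (φ.toGNS b)) y =
      inner ℂ (φ.toGNS b) (φ.gnsOperator hφ a y)) y
      (isClosed_eq (by fun_prop) (by fun_prop)) fun c => ?_
    simp [gnsOperator_apply, inner_toGNS, mul_assoc]

theorem gnsRep_apply (a b : A) : φ.gnsRep hφ a (φ.toGNS b) = φ.toGNS (a * b) :=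
  φ.gnsOperator_apply hφ a b

/-- The class of `1` is a vector implementing `φ`, with squared norm `φ(1)`; the rest is
Cauchy–Schwarz. -/
theorem norm_apply_le_gnsRep (a : A) :
    ‖φ.toLinearMap a‖ ≤ ‖φ.gnsRep hφ a‖ * (φ.toLinearMap 1).re := by
  have h1 : φ.toLinearMap a = inner ℂ (φ.toGNS 1) (φ.gnsRep hφ a (φ.toGNS 1)) := by
    rw [gnsRep_apply, inner_toGNS, star_one, one_mul, mul_one]
  have h2 : ‖φ.toGNS 1‖ * ‖φ.toGNS 1‖ = (φ.toLinearMap 1).re := by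
    rw [← sq, ← inner_self_eq_norm_sq (𝕜 := ℂ), inner_toGNS, star_one, one_mul]
    rfl
  rw [h1, ← h2, mul_left_comm]
  exact (norm_inner_le_norm _ _).trans
    (mul_le_mul_of_nonneg_left (ContinuousLinearMap.le_opNorm _ _) (norm_nonneg _))

end PositiveFunctional

end CrossedProduct

end

noncomputable section

namespace CrossedProduct

/-! ### Continuous functions -/

section CFun

variable {X : Type v} [TopologicalSpace X]

/-- A continuous function as an element of the C⋆-algebra `C(X)`. -/
def CFun.mk (f : C(X, ℂ)) : CFun X := f

theorem CFun.mk_apply (f : C(X, ℂ)) (x : X) : CFun.mk f x = f x := rfl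

theorem CFun.ext {f g : CFun X} (h : ∀ x, f x = g x) : f = g := DFunLike.ext _ _ h

theorem CFun.continuous (f : CFun X) : Continuous f := ContinuousMap.continuous (f : C(X, ℂ))

variable [CompactSpace X]

theorem CFun.add_apply (f g : CFun X) (x : X) : (f + g) x = f x + g x := rfl

theorem CFun.mul_apply (f g : CFun X) (x : X) : (f * g) x = f x * g x := rfl

theorem CFun.star_apply (f : CFun X) (x : X) : (star f) x = star (f x) := rfl

theorem CFun.smul_apply (c : ℂ) (f : CFun X) (x : X) : (c • f) x = c * f x := rfl

theorem CFun.one_apply (x : X) : (1 : CFun X) x = 1 := rfl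

theorem CFun.sum_apply {ι : Type*} (s : Finset ι) (f : ι → CFun X) (x : X) :
    (∑ i ∈ s, f i) x = ∑ i ∈ s, f i x :=
  map_sum (⟨⟨fun f => f x, rfl⟩, fun _ _ => rfl⟩ : CFun X →+ ℂ) f s

theorem CFun.norm_apply_le (f : CFun X) (x : X) : ‖f x‖ ≤ ‖f‖ :=
  ContinuousMap.norm_coe_le_norm (f : C(X, ℂ)) x

theorem CFun.norm_le {f : CFun X} {C : ℝ} (hC : 0 ≤ C) : ‖f‖ ≤ C ↔ ∀ x, ‖f x‖ ≤ C :=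
  ContinuousMap.norm_le (f : C(X, ℂ)) hC

/-- Take `g = √(‖f‖² - |f|²)`. This writes `f^* f ≤ ‖f‖²` as a purely algebraic identity, which
positive functionals can use without any continuity assumption. -/
theorem CFun.exists_add_star_mul_self (f : CFun X) :
    ∃ g : CFun X, star f * f + star g * g = ((‖f‖ ^ 2 : ℝ) : ℂ) • 1 := by
  have hf := f.continuous
  refine ⟨CFun.mk ⟨fun x => ((√(‖f‖ ^ 2 - ‖f x‖ ^ 2) : ℝ) : ℂ), by fun_prop⟩, CFun.ext fun x => ?_⟩
  have h : 0 ≤ ‖f‖ ^ 2 - ‖f x‖ ^ 2 :=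
    sub_nonneg.2 (pow_le_pow_left₀ (norm_nonneg _) (f.norm_apply_le x) 2)
  have h1 : star (f x) * f x = ((‖f x‖ ^ 2 : ℝ) : ℂ) := by
    rw [Complex.star_def, Complex.conj_mul', Complex.ofReal_pow]
  rw [CFun.add_apply, CFun.mul_apply, CFun.mul_apply, CFun.star_apply, CFun.star_apply, h1,
    CFun.mk_apply, CFun.smul_apply, CFun.one_apply, mul_one]
  simp only [ContinuousMap.coe_mk, Complex.star_def, Complex.conj_ofReal]
  rw [← Complex.ofReal_mul, Real.mul_self_sqrt h, ← Complex.ofReal_add]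
  ring_nf

end CFun

variable {Γ : Type u} {X : Type v} [Group Γ] [TopologicalSpace X] [CompactSpace X] [MulAction Γ X]
  [ContinuousConstSMul Γ X]

/-! ### Isomorphisms between completions with the same norm -/

namespace CStarCompletion

variable {P Q : Rep Γ X → Prop}

/-- The identity of the convolution algebra, extended to a map between completions. -/
def mapId (P Q : Rep Γ X → Prop) : CStarCompletion P → CStarCompletion Q :=
  UniformSpace.Completion.map (α := Pre P) (β := Pre Q) fun a => a

theorem continuous_mapId : Continuous (mapId P Q) := UniformSpace.Completion.continuous_map

/-- Equal seminorms make the identity an isometry, hence uniformly continuous; without this the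
induced map of completions need not extend the identity. -/
theorem mapId_coe (h : ∀ a : ConvAlg Γ X, repNorm P a = repNorm Q a) (a : ConvAlg Γ X) :
    mapId P Q (coe P a) = coe Q a := by
  let f : Pre P →+ Pre Q := AddMonoidHom.id (ConvAlg Γ X)
  have hf : Isometry f := AddMonoidHomClass.isometry_of_norm f fun a => (h a).symm
  exact UniformSpace.Completion.map_coe hf.uniformContinuous a

theorem mapId_mapId (h : ∀ a : ConvAlg Γ X, repNorm P a = repNorm Q a) (x : CStarCompletion P) :
    mapId Q P (mapId P Q x) = x := by
  refine ind (p := fun x => mapId Q P (mapId P Q x) = x) x ?_ fun a => ?_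
  · exact isClosed_eq (continuous_mapId.comp continuous_mapId) continuous_id
  · exact (congrArg _ (mapId_coe h a)).trans (mapId_coe (fun a => (h a).symm) a)

/-- Completions with respect to equal norms are isomorphic. -/
def equivOfNormEq (h : ∀ a : ConvAlg Γ X, repNorm P a = repNorm Q a) :
    CStarCompletion P ≃⋆ₐ[ℂ] CStarCompletion Q where
  toFun := mapId P Q
  invFun := mapId Q P
  left_inv := mapId_mapId h
  right_inv := mapId_mapId fun a => (h a).symm
  map_add' x y := by
    refine ind (p := fun x => mapId P Q (x + y) = mapId P Q x + mapId P Q y) x ?_ fun a => ?_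
    · exact isClosed_eq (continuous_mapId.comp (continuous_add_const y))
        (continuous_mapId.add continuous_const)
    refine ind (p := fun y => mapId P Q (coe P a + y) = mapId P Q (coe P a) + mapId P Q y) y ?_
      fun b => ?_
    · exact isClosed_eq (continuous_mapId.comp (continuous_const_add _))
        (continuous_const.add continuous_mapId)
    · rw [← coe_add]
      exact (mapId_coe h _).trans ((coe_add Q a b).trans
        (congrArg₂ (· + ·) (mapId_coe h a).symm (mapId_coe h b).symm))
  map_mul' x y := by
    refine ind (p := fun x => mapId P Q (x * y) = mapId P Q x * mapId P Q y) x ?_ fun a => ?_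
    · exact isClosed_eq (continuous_mapId.comp (continuous_mul_const y))
        (continuous_mapId.mul continuous_const)
    refine ind (p := fun y => mapId P Q (coe P a * y) = mapId P Q (coe P a) * mapId P Q y) y ?_
      fun b => ?_
    · exact isClosed_eq (continuous_mapId.comp (continuous_const_mul _))
        (continuous_const.mul continuous_mapId)
    · rw [← coe_mul]
      exact (mapId_coe h _).trans ((coe_mul Q a b).trans
        (congrArg₂ (· * ·) (mapId_coe h a).symm (mapId_coe h b).symm))
  map_star' x := by
    refine ind (p := fun x => mapId P Q (star x) = star (mapId P Q x)) x ?_ fun a => ?_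
    · exact isClosed_eq (continuous_mapId.comp (continuous_star' P))
        ((continuous_star' Q).comp continuous_mapId)
    · rw [← coe_star]
      exact (mapId_coe h _).trans ((coe_star Q a).trans (congrArg star (mapId_coe h a).symm))
  map_smul' c x := by
    refine ind (p := fun x => mapId P Q (c • x) = c • mapId P Q x) x ?_ fun a => ?_
    · exact isClosed_eq (continuous_mapId.comp (continuous_const_smul c))
        (continuous_mapId.const_smul c)
    · rw [← coe_smul]
      exact (mapId_coe h _).trans ((coe_smul Q c a).trans (congrArg (c • ·) (mapId_coe h a).symm))

theorem equivOfNormEq_of (h : ∀ a : ConvAlg Γ X, repNorm P a = repNorm Q a) (a : ConvAlg Γ X) :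
    equivOfNormEq h (of P a) = of Q a := mapId_coe h a

end CStarCompletion

theorem CFun.norm_action_le (s : Γ) (f : CFun X) : ‖s • f‖ ≤ ‖f‖ :=
  (CFun.norm_le (norm_nonneg f)).2 fun x => f.norm_apply_le (s⁻¹ • x)

/-! ### Positive functionals on the convolution algebra -/

open SkewMonoidAlgebra

theorem star_single_mul_single (s t : Γ) (f g : CFun X) :
    star (single s f : ConvAlg Γ X) * single t g = single (s⁻¹ * t) (s⁻¹ • (star f * g)) := by
  rw [star_single, single_mul_single, smul_mul']

/-- Boundedness is automatic. For a monomial `f s`, the complement `g` with `f^* f + g^* g = ‖f‖²`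
gives `φ((f s b)^* (f s b)) ≤ ‖f‖² φ(b^* b)`, the discarded term being a positive value of `φ`. -/
theorem isLeftBounded (φ : PositiveFunctional (ConvAlg Γ X)) (a : ConvAlg Γ X) :
    φ.IsLeftBounded a := by
  induction a using SkewMonoidAlgebra.induction_on with
  | zero => exact φ.isLeftBounded_zero
  | add a b ha hb => exact ha.add hb
  | single s f =>
    refine ⟨‖f‖, fun b => ?_⟩
    refine le_of_sq_le_sq ?_ (by positivity)
    obtain ⟨g, hg⟩ := f.exists_add_star_mul_self
    have h : star (single s f * b) * (single s f * b) + star (single s g * b) * (single s g * b)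
        = ((‖f‖ ^ 2 : ℝ) : ℂ) • (star b * b) := by
      have h1 : (single (s⁻¹ * s) (s⁻¹ • (star f * f)) + single (s⁻¹ * s) (s⁻¹ • (star g * g)) :
          ConvAlg Γ X) = ((‖f‖ ^ 2 : ℝ) : ℂ) • 1 := by
        rw [← single_add, ← smul_add, hg, inv_mul_cancel, smul_comm, smul_one, one_def,
          smul_single]
      calc _ = star b * (star (single s f) * single s f + star (single s g) * single s g) * b := by
            rw [star_mul, star_mul]; noncomm_ring
        _ = _ := by
            rw [star_single_mul_single, star_single_mul_single, h1, mul_smul_comm, mul_one,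
              smul_mul_assoc]
    have h2 := congrArg Complex.re (congrArg φ.toLinearMap h)
    rw [map_add, map_smul, Complex.add_re, smul_eq_mul, Complex.re_ofReal_mul] at h2
    have h3 := (Complex.nonneg_iff.1 (φ.nonneg (single s g * b))).1
    rw [mul_pow, φ.norm_toPreGNS_sq, φ.norm_toPreGNS_sq, ← h2]
    exact le_add_of_nonneg_right h3

/-- The GNS representation of a positive functional on the convolution algebra. -/
def gns (φ : PositiveFunctional (ConvAlg Γ X)) : Rep Γ X where
  H := φ.GNS
  π := φ.gnsRep (isLeftBounded φ)

/-! ### Matrix coefficients of GNS representations. -/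

theorem matrixCoeff_add_left {H : Type*} [NormedAddCommGroup H] [InnerProductSpace ℂ H]
    [CompleteSpace H] (U : Γ →* unitary (H →L[ℂ] H)) (ξ ξ' η : H) :
    matrixCoeff U (ξ + ξ') η = matrixCoeff U ξ η + matrixCoeff U ξ' η := by
  refine lp.ext (funext fun s => ?_)
  change inner ℂ η ((U s : H →L[ℂ] H) (ξ + ξ')) =
    inner ℂ η ((U s : H →L[ℂ] H) ξ) + inner ℂ η ((U s : H →L[ℂ] H) ξ')
  rw [map_add, inner_add_right]

theorem matrixCoeff_add_right {H : Type*} [NormedAddCommGroup H] [InnerProductSpace ℂ H]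
    [CompleteSpace H] (U : Γ →* unitary (H →L[ℂ] H)) (ξ η η' : H) :
    matrixCoeff U ξ (η + η') = matrixCoeff U ξ η + matrixCoeff U ξ η' := by
  exact lp.ext (funext fun s => inner_add_left _ _ _)

theorem matrixCoeff_zero_left {H : Type*} [NormedAddCommGroup H] [InnerProductSpace ℂ H]
    [CompleteSpace H] (U : Γ →* unitary (H →L[ℂ] H)) (η : H) : matrixCoeff U 0 η = 0 := by
  ext s
  simp [matrixCoeff]

theorem matrixCoeff_zero_right {H : Type*} [NormedAddCommGroup H] [InnerProductSpace ℂ H]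
    [CompleteSpace H] (U : Γ →* unitary (H →L[ℂ] H)) (ξ : H) : matrixCoeff U ξ 0 = 0 := by
  ext s
  simp [matrixCoeff]

/-- An ideal contains every bounded function dominated by a translate of `w`. -/
def ContainsTranslates (D : Ideal (EllInfty Γ)) (w : Γ → ℝ) : Prop :=
  ∀ (F : EllInfty Γ) (r t : Γ) (C : ℝ), (∀ s, ‖F s‖ ≤ C * w (r * s * t)) → F ∈ D

/-- The canonical map of the convolution algebra into the GNS representation. -/
def gnsVector (φ : PositiveFunctional (ConvAlg Γ X)) : ConvAlg Γ X →ₗ[ℂ] (gns φ).H := φ.toGNS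

theorem matrixCoeff_gns (φ : PositiveFunctional (ConvAlg Γ X)) (a b : ConvAlg Γ X) (s : Γ) :
    matrixCoeff (gns φ).restrict (gnsVector φ a) (gnsVector φ b) s =
      φ.toLinearMap (star b * (single s 1 * a)) := by
  change inner ℂ (φ.toGNS b) (φ.gnsRep (isLeftBounded φ) (single s 1) (φ.toGNS a)) = _
  rw [φ.gnsRep_apply, φ.inner_toGNS]

/-- The dense subspace is the image of the algebra. By sesquilinearity only monomials `f t` and `g
r` matter, and their coefficient at `s` is `φ` of a monomial supported at `r⁻¹ s t`; this is why
two-sided translates of `w` are needed. -/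
theorem isDRep_gns {D : Ideal (EllInfty Γ)} (φ : PositiveFunctional (ConvAlg Γ X)) {w : Γ → ℝ}
    (hw : ∀ s, 0 ≤ w s) (hφ : ∀ s f, ‖φ.toLinearMap (single s f)‖ ≤ ‖f‖ * w s)
    (hD : ContainsTranslates D w) : (gns φ).IsDRep D := by
  refine ⟨LinearMap.range (gnsVector φ), φ.denseRange_toGNS, ?_⟩
  rintro _ ⟨a, rfl⟩ _ ⟨b, rfl⟩
  induction a using SkewMonoidAlgebra.induction_on with
  | zero =>
    rw [map_zero, matrixCoeff_zero_left]
    exact D.zero_mem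
  | add a a' ha ha' =>
    rw [map_add, matrixCoeff_add_left]
    exact D.add_mem ha ha'
  | single t f =>
    induction b using SkewMonoidAlgebra.induction_on with
    | zero =>
      rw [map_zero, matrixCoeff_zero_right]
      exact D.zero_mem
    | add b b' hb hb' =>
      rw [map_add, matrixCoeff_add_right]
      exact D.add_mem hb hb'
    | single r g =>
      refine hD _ r⁻¹ t (‖g‖ * ‖f‖) fun s => ?_
      refine (congrArg norm (matrixCoeff_gns φ _ _ s)).le.trans ?_
      rw [single_mul_single, star_single_mul_single, one_mul, ← mul_assoc]
      refine (hφ _ _).trans (mul_le_mul_of_nonneg_right ?_ (hw _))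
      refine (CFun.norm_action_le _ _).trans ((norm_mul_le _ _).trans ?_)
      rw [norm_star]
      exact mul_le_mul_of_nonneg_left (CFun.norm_action_le _ _) (norm_nonneg _)

end CrossedProduct

end

noncomputable section

namespace CrossedProduct

open SkewMonoidAlgebra

theorem eq_sum_support {A G : Type*} [AddCommMonoid A] (a : SkewMonoidAlgebra A G) :
    a = ∑ s : a.support, single (s : G) (a.coeff s) := by
  conv_lhs => rw [← sum_single a, sum_def']
  exact (Finset.sum_coe_sort a.support fun s => single s (a.coeff s)).symm

theorem single_sum {A G ι : Type*} [AddCommMonoid A] (s : Finset ι) (g : G) (f : ι → A) :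
    single g (∑ i ∈ s, f i) = ∑ i ∈ s, single g (f i) :=
  _root_.map_sum (singleAddHom g) f s

theorem PositiveDefinite.posSemidef {Γ X : Type*} [Group Γ] [MulAction Γ X] {h : X × Γ → ℂ}
    (hh : PositiveDefinite h) {ι : Type*} [Fintype ι] (s : ι → Γ) (x : X) :
    (Matrix.of fun i j => h (s i • x, s i * (s j)⁻¹)).PosSemidef := by
  let e := Fintype.equivFin ι
  have := (hh _ (fun i => s (e.symm i)) x).submatrix e
  convert this using 1
  ext i j
  simp

section Multiplier

/-! ### Multipliers of the convolution algebra -/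

variable {Γ : Type u} {X : Type v} [TopologicalSpace X] [CompactSpace X]

/-- Pointwise multiplication by a family of functions, `∑ f_s s ↦ ∑ f_s k_s s`. -/
def multiplier (k : Γ → CFun X) : ConvAlg Γ X →ₗ[ℂ] ConvAlg Γ X where
  toFun a := a.sum fun s f => single s (f * k s)
  map_add' a b := sum_add_index' (by simp) (by intro s f g; simp [add_mul, single_add])
  map_smul' c a := by
    induction a using SkewMonoidAlgebra.induction_on with
    | zero => simp
    | single s f =>
      rw [smul_single, sum_single_index (by simp), sum_single_index (by simp), RingHom.id_apply,
        smul_single, smul_mul_assoc]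
    | add a b ha hb =>
      have h : ∀ a b : ConvAlg Γ X, (a + b).sum (fun s f => (single s (f * k s) : ConvAlg Γ X)) =
          a.sum (fun s f => single s (f * k s)) + b.sum (fun s f => single s (f * k s)) :=
        fun a b => sum_add_index' (by simp) (by intro s f g; simp [add_mul, single_add])
      rw [smul_add, h, h, ha, hb, smul_add]

theorem multiplier_single (k : Γ → CFun X) (s : Γ) (f : CFun X) :
    multiplier k (single s f) = single s (f * k s) := by
  change (single s f : ConvAlg Γ X).sum (fun s f => (single s (f * k s) : ConvAlg Γ X)) = _
  exact sum_single_index (by simp)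

variable [Group Γ] [MulAction Γ X] [ContinuousConstSMul Γ X]

/-- Multiplying the terms of `a^* a` by `k` amounts to a Schur product of a rank-one matrix with a
positive semidefinite one, at each point of `X`. A continuous factorization `G^* G` of the result
yields one element `c_r` for each row of `G`. -/
theorem exists_multiplier_star_mul_self (k : Γ → CFun X)
    (hk : PositiveDefinite fun p : X × Γ => k p.2 p.1) (a : ConvAlg Γ X) :
    ∃ c : a.support → ConvAlg Γ X, multiplier k (star a * a) = ∑ r, star (c r) * c r := by
  classical
  let f : a.support → CFun X := fun s => a.coeff s
  -- The factor from `k` is the matrix of positive definiteness for the group elements `s⁻¹`, since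
  -- `s⁻¹ (t⁻¹)⁻¹ = s⁻¹ t`; the functions `f` conjugate it by a diagonal matrix.
  let F : X → Matrix a.support a.support ℂ := fun x => Matrix.of fun s t =>
    star (f s x) * k ((s : Γ)⁻¹ * t) ((s : Γ)⁻¹ • x) * f t x
  have hF : Continuous F := by
    refine continuous_matrix fun s t => ?_
    exact ((f s).continuous.star.mul
      ((k _).continuous.comp (continuous_const_smul _))).mul (f t).continuous
  have hp : ∀ x, (F x).PosSemidef := fun x => by
    have h := (hk.posSemidef (fun s : a.support => (s : Γ)⁻¹) x).conjTranspose_mul_mul_same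
      (Matrix.diagonal fun s => f s x)
    convert h using 1
    ext s t
    simp [F, Matrix.diagonal_conjTranspose, Matrix.diagonal_mul,
      Matrix.mul_diagonal]
  obtain ⟨G, hG, hFG⟩ := exists_continuous_conjTranspose_mul_self F hF hp
  let g : a.support → a.support → CFun X := fun r t => CFun.mk ⟨fun x => G x r t, hG.matrix_elem r t⟩
  refine ⟨fun r => ∑ t : a.support, single (t : Γ) (g r t), ?_⟩
  have hfg : ∀ s t : a.support, ((s : Γ)⁻¹ • (star (f s) * f t)) * k ((s : Γ)⁻¹ * t) =
      ∑ r, (s : Γ)⁻¹ • (star (g r s) * g r t) := fun s t => CFun.ext fun x => by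
    -- The involution translates coefficients by `s⁻¹`, so the identity at `x` is the matrix
    -- identity at `s • x`.
    have h := congrFun (congrFun (hFG ((s : Γ) • x)) s) t
    simp only [F, Matrix.of_apply, inv_smul_smul, Matrix.mul_apply, Matrix.conjTranspose_apply] at h
    simp only [CFun.mul_apply, CFun.sum_apply, action_apply, CFun.star_apply, inv_inv, g,
      CFun.mk_apply, ContinuousMap.coe_mk]
    rw [← h]
    ring
  have ha : star a * a = ∑ s : a.support, ∑ t : a.support,
      single ((s : Γ)⁻¹ * t) ((s : Γ)⁻¹ • (star (f s) * f t)) := by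
    conv_lhs => rw [eq_sum_support a]
    simp only [star_sum, Finset.sum_mul_sum, star_single_mul_single, f]
  rw [ha]
  simp only [star_sum, Finset.sum_mul_sum, _root_.map_sum, star_single_mul_single,
    multiplier_single, hfg, single_sum]
  rw [Finset.sum_comm_cycle]

/-! ### Approximation of states -/

variable (ρ : Rep Γ X) (ξ : ρ.H)

/-- The vector functional of `ξ`, composed with the multiplier given by `k`. -/
def multipliedState (k : Γ → CFun X) (hk : PositiveDefinite fun p : X × Γ => k p.2 p.1) :
    PositiveFunctional (ConvAlg Γ X) where
  toLinearMap :=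
    { toFun := fun a => inner ℂ ξ (ρ.π (multiplier k a) ξ)
      map_add' := fun a b => by simp
      map_smul' := fun c a => by simp }
  nonneg a := by
    change 0 ≤ inner ℂ ξ (ρ.π (multiplier k (star a * a)) ξ)
    obtain ⟨c, hc⟩ := exists_multiplier_star_mul_self k hk a
    rw [hc, _root_.map_sum, sum_apply, inner_sum]
    -- Each summand is `‖π(c_r) ξ‖²`.
    refine Finset.sum_nonneg fun r _ => ?_
    rw [map_mul, map_star, mul_apply_eq_comp, ContinuousLinearMap.star_eq_adjoint,
      ContinuousLinearMap.adjoint_inner_right, inner_self_eq_norm_sq_to_K]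
    rw [← RCLike.ofReal_pow]
    exact RCLike.ofReal_nonneg.2 (sq_nonneg _)

theorem multipliedState_apply (k : Γ → CFun X)
    (hk : PositiveDefinite fun p : X × Γ => k p.2 p.1) (a : ConvAlg Γ X) :
    (multipliedState ρ ξ k hk).toLinearMap a = inner ℂ ξ (ρ.π (multiplier k a) ξ) := rfl

theorem norm_multipliedState_single_le (k : Γ → CFun X)
    (hk : PositiveDefinite fun p : X × Γ => k p.2 p.1) (s : Γ) (f : CFun X) :
    ‖(multipliedState ρ ξ k hk).toLinearMap (single s f)‖ ≤ ‖f‖ * (‖k s‖ * ‖ξ‖ ^ 2) := by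
  rw [multipliedState_apply, multiplier_single]
  calc _ ≤ ‖ξ‖ * (‖f * k s‖ * ‖ξ‖) := (norm_inner_le_norm _ _).trans
        (mul_le_mul_of_nonneg_left (ContinuousLinearMap.le_of_opNorm_le _
          (norm_rep_single_le ρ s _) _) (norm_nonneg _))
    _ ≤ ‖ξ‖ * (‖f‖ * ‖k s‖ * ‖ξ‖) := by gcongr; exact norm_mul_le _ _
    _ = _ := by ring

/-- Elements are finite sums and each monomial is represented contractively, so convergence of each
`k_n(s)` suffices, even for the operator norm. -/
theorem tendsto_rep_multiplier {k : ℕ → Γ → CFun X}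
    (hk : ∀ s, Tendsto (fun n => k n s) atTop (𝓝 1)) (a : ConvAlg Γ X) :
    Tendsto (fun n => ρ.π (multiplier (k n) a)) atTop (𝓝 (ρ.π a)) := by
  induction a using SkewMonoidAlgebra.induction_on with
  | zero => simp
  | add a b ha hb => simpa using ha.add hb
  | single s f =>
    refine tendsto_iff_norm_sub_tendsto_zero.2 (squeeze_zero (fun _ => norm_nonneg _) (fun n => ?_)
      (tendsto_iff_norm_sub_tendsto_zero.1 ((hk s).const_mul f)))
    rw [multiplier_single, ← map_sub, mul_one, sub_eq_add_neg (single s _), ← single_neg,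
      ← single_add, ← sub_eq_add_neg]
    exact norm_rep_single_le ρ s _

/-- Every vector functional is a pointwise limit of functionals whose GNS representations are
`D`-representations, so the `D`-norm controls every representation. -/
theorem repNorm_eq_of_multipliers {D : Ideal (EllInfty Γ)} (k : ℕ → Γ → CFun X)
    (hpos : ∀ n, PositiveDefinite fun p : X × Γ => k n p.2 p.1)
    (hconv : ∀ s, Tendsto (fun n => k n s) atTop (𝓝 1))
    (hD : ∀ n, ContainsTranslates D fun s => ‖k n s‖) (a : ConvAlg Γ X) :
    repNorm (fun _ : Rep Γ X => True) a = repNorm (fun ρ : Rep Γ X => ρ.IsDRep D) a := by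
  set N : ConvAlg Γ X → ℝ := repNorm (fun ρ : Rep Γ X => ρ.IsDRep D) with hN
  have hN0 : ∀ a, 0 ≤ N a := repNorm_nonneg _
  refine le_antisymm (repNorm_le _ (hN0 a) fun ρ _ => ?_)
    (repNorm_le _ (repNorm_nonneg _ a) fun ρ _ => le_repNorm _ a ρ trivial)
  refine ContinuousLinearMap.opNorm_le_bound _ (hN0 a) fun ξ => ?_
  have hlim : ∀ b, Tendsto (fun n => (multipliedState ρ ξ (k n) (hpos n)).toLinearMap b) atTop
      (𝓝 (inner ℂ ξ (ρ.π b ξ))) := fun b =>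
    tendsto_const_nhds.inner (((ContinuousLinearMap.apply ℂ ρ.H ξ).continuous.tendsto _).comp
      (tendsto_rep_multiplier ρ hconv b))
  have hbound : ∀ n, ‖(multipliedState ρ ξ (k n) (hpos n)).toLinearMap (star a * a)‖ ≤
      N (star a * a) * ((multipliedState ρ ξ (k n) (hpos n)).toLinearMap 1).re := fun n => by
    set φ := multipliedState ρ ξ (k n) (hpos n) with hφ
    have hrep : (gns φ).IsDRep D := by
      refine isDRep_gns φ (w := fun s => ‖k n s‖ * ‖ξ‖ ^ 2) (fun s => by positivity)
        (norm_multipliedState_single_le ρ ξ (k n) (hpos n)) fun F r t C hF => ?_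
      -- The factor `‖ξ‖²` in the weight is absorbed into the constant.
      refine hD n F r t (C * ‖ξ‖ ^ 2) fun s => (hF s).trans (le_of_eq (by ring))
    have h0 : 0 ≤ (φ.toLinearMap 1).re := by
      simpa using (Complex.nonneg_iff.1 (φ.nonneg 1)).1
    exact (φ.norm_apply_le_gnsRep (isLeftBounded φ) _).trans
      (mul_le_mul_of_nonneg_right (le_repNorm _ _ (gns φ) hrep) h0)
  have h1 := le_of_tendsto_of_tendsto' (hlim (star a * a)).norm
    (((Complex.continuous_re.tendsto _).comp (hlim 1)).const_mul (N (star a * a))) hbound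
  have h2 : N (star a * a) ≤ N a * N a := by
    have h : N (star a * a) ≤ N (star a) * N a :=
      -- The `D`-norm is already a submultiplicative seminorm on the type synonym `Pre`.
      norm_mul_le (α := Pre fun ρ : Rep Γ X => ρ.IsDRep D) _ _
    rwa [hN, repNorm_star] at h
  have h3 : inner ℂ ξ (ρ.π (star a * a) ξ) = ((‖ρ.π a ξ‖ ^ 2 : ℝ) : ℂ) := by
    rw [map_mul, map_star, mul_apply_eq_comp, ContinuousLinearMap.star_eq_adjoint,
      ContinuousLinearMap.adjoint_inner_right, inner_self_eq_norm_sq_to_K]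
    simp
  have h4 : (inner ℂ ξ (ρ.π 1 ξ)).re = ‖ξ‖ ^ 2 := by
    rw [map_one, one_apply_eq_self, ← inner_self_eq_norm_sq (𝕜 := ℂ)]
    rfl
  rw [h3, h4, Complex.norm_real, Real.norm_of_nonneg (sq_nonneg _)] at h1
  refine le_of_sq_le_sq ?_ (mul_nonneg (hN0 a) (norm_nonneg ξ))
  calc _ ≤ N (star a * a) * ‖ξ‖ ^ 2 := h1
    _ ≤ N a * N a * ‖ξ‖ ^ 2 := mul_le_mul_of_nonneg_right h2 (sq_nonneg _)
    _ = _ := by ring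

theorem fullEqIdealCompletion_of_multipliers {D : Ideal (EllInfty Γ)} (k : ℕ → Γ → CFun X)
    (hpos : ∀ n, PositiveDefinite fun p : X × Γ => k n p.2 p.1)
    (hconv : ∀ s, Tendsto (fun n => k n s) atTop (𝓝 1))
    (hD : ∀ n, ContainsTranslates D fun s => ‖k n s‖) : FullEqIdealCompletion X D :=
  ⟨CStarCompletion.equivOfNormEq (repNorm_eq_of_multipliers k hpos hconv hD),
    CStarCompletion.equivOfNormEq_of _⟩

end Multiplier

/-! ### Sections of functions on `X × Γ` -/

section Sections

variable {Γ : Type u} {X : Type v} [TopologicalSpace Γ] [TopologicalSpace X]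

/-- The function `x ↦ h(x, s)`. -/
def sectionAt (h : C(X × Γ, ℂ)) (s : Γ) : CFun X := CFun.mk (h.comp ⟨fun x => (x, s), by fun_prop⟩)

/-- The projection of a compact set to the discrete group is compact, hence finite. This converts
compact support or decay on `X × Γ` into finite support or decay of the sup norms of the sections.
-/
theorem finite_setOf_exists_mem [DiscreteTopology Γ] {K : Set (X × Γ)} (hK : IsCompact K) :
    {s : Γ | ∃ x, (x, s) ∈ K}.Finite := by
  refine (hK.image continuous_snd).finite_of_discrete.subset ?_
  rintro s ⟨x, hx⟩
  exact ⟨_, hx, rfl⟩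

variable [CompactSpace X]

theorem tendsto_sectionAt {h : ℕ → C(X × Γ, ℂ)} (hh : ∀ K : Set (X × Γ), IsCompact K →
      TendstoUniformlyOn (fun n p => h n p) (fun _ => (1 : ℂ)) atTop K) (s : Γ) :
    Tendsto (fun n => sectionAt (h n) s) atTop (𝓝 1) := by
  -- As `X` is compact, so is the slice `X × {s}`, and uniform convergence on it is norm convergence
  -- in `C(X)`.
  have h1 := Metric.tendstoUniformlyOn_iff.1 (hh (Set.univ ×ˢ {s}) (isCompact_univ.prod
    isCompact_singleton))
  refine Metric.tendsto_nhds.2 fun ε hε => ?_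
  -- Pointwise strict bounds give only a weak bound on the sup norm, hence the half.
  filter_upwards [h1 (ε / 2) (half_pos hε)] with n hn
  rw [dist_eq_norm]
  refine ((CFun.norm_le (half_pos hε).le).2 fun x => ?_).trans_lt (half_lt_self hε)
  have h2 := hn (x, s) (by simp)
  rw [dist_comm, dist_eq_norm] at h2
  exact h2.le

variable [DiscreteTopology Γ]

theorem finite_setOf_sectionAt_ne_zero {h : C(X × Γ, ℂ)} (hh : HasCompactSupport h) :
    {s : Γ | ‖sectionAt h s‖ ≠ 0}.Finite := by
  refine (finite_setOf_exists_mem hh).subset fun s hs => ?_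
  by_contra hx
  refine hs (norm_eq_zero.2 (CFun.ext fun x => ?_))
  by_contra hne
  exact hx ⟨x, subset_tsupport _ hne⟩

theorem tendsto_norm_sectionAt {h : C(X × Γ, ℂ)} (hh : Tendsto h (cocompact (X × Γ)) (𝓝 0)) :
    Tendsto (fun s : Γ => ‖sectionAt h s‖) cofinite (𝓝 0) := by
  refine Metric.tendsto_nhds.2 fun ε hε => ?_
  obtain ⟨K, hK, hKε⟩ := mem_cocompact.1 (Metric.tendsto_nhds.1 hh (ε / 2) (half_pos hε))
  refine (finite_setOf_exists_mem hK).subset fun s hs => ?_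
  by_contra hx
  refine hs ?_
  have h1 : ‖sectionAt h s‖ ≤ ε / 2 := (CFun.norm_le (half_pos hε).le).2 fun x => by
    have h2 : dist (h (x, s)) 0 < ε / 2 := hKε fun hmem => hx ⟨x, hmem⟩
    rw [dist_zero_right] at h2
    exact h2.le
  change dist ‖sectionAt h s‖ 0 < ε
  rw [dist_zero_right, norm_norm]
  exact h1.trans_lt (half_lt_self hε)

end Sections

/-! ### Translates and the ideals `c_c(Γ)` and `c_0(Γ)`. -/

theorem mul_mul_injective {Γ : Type*} [Group Γ] (r t : Γ) :
    Function.Injective fun s : Γ => r * s * t :=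
  (mul_left_injective t).comp (mul_right_injective r)

theorem containsTranslates_ccIdeal {Γ : Type u} [Group Γ] {w : Γ → ℝ}
    (hw : {s | w s ≠ 0}.Finite) : ContainsTranslates (ccIdeal Γ) w := by
  intro F r t C hF
  refine (hw.preimage (mul_mul_injective r t).injOn).subset fun s hs h0 => hs ?_
  refine norm_le_zero_iff.1 ((hF s).trans ?_)
  rw [show w (r * s * t) = 0 from h0, mul_zero]

/-- Two-sided translation is injective, so it tends to infinity along the cofinite filter, and a
translate of `w` still vanishes at infinity. -/
theorem containsTranslates_c0Ideal {Γ : Type u} [Group Γ] {w : Γ → ℝ}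
    (hw : Tendsto w cofinite (𝓝 0)) : ContainsTranslates (c0Ideal Γ) w := by
  intro F r t C hF
  refine squeeze_zero_norm hF ?_
  simpa using (hw.comp (mul_mul_injective r t).tendsto_cofinite).const_mul C

end CrossedProduct

end

theorem mainTheorem5 {Γ : Type u} {X : Type v} [Group Γ] [TopologicalSpace Γ] [DiscreteTopology Γ]
    [TopologicalSpace X] [CompactSpace X] [T2Space X] [MulAction Γ X] [ContinuousConstSMul Γ X] :
    (CrossedProduct.IsAmenableAction Γ X →
      CrossedProduct.FullEqIdealCompletion X (CrossedProduct.ccIdeal Γ)) ∧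
    (CrossedProduct.IsATMenableAction Γ X →
      CrossedProduct.FullEqIdealCompletion X (CrossedProduct.c0Ideal Γ)) := by
  constructor
  · rintro ⟨h, hpos, hconv⟩
    exact CrossedProduct.fullEqIdealCompletion_of_multipliers
      (fun n => CrossedProduct.sectionAt (h n : C(X × Γ, ℂ))) hpos
      (CrossedProduct.tendsto_sectionAt hconv) fun n =>
      CrossedProduct.containsTranslates_ccIdeal
        (CrossedProduct.finite_setOf_sectionAt_ne_zero (h n).hasCompactSupport)
  · rintro ⟨h, hpos, hconv⟩
    exact CrossedProduct.fullEqIdealCompletion_of_multipliers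
      (fun n => CrossedProduct.sectionAt (h n : C(X × Γ, ℂ))) hpos
      (CrossedProduct.tendsto_sectionAt hconv) fun n =>
      CrossedProduct.containsTranslates_c0Ideal
        (CrossedProduct.tendsto_norm_sectionAt (h n).zero_at_infty')
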